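/- Let $H\in(0,1)$ and $c>0$. Then there is a constant $\kappa_H>0$, depending only on $H$ and $c$, with the following property. Let $Z=(Z_t)_{t\ge 0}$ be a one-dimensional centered Gaussian process on a probability space which is self-similar with index $H$, i.e. for every $a>0$ the processes $(Z_{at})_{t\ge0}$ and $(a^HZ_t)_{t\ge0}$ have the same finite-dimensional distributions. Let $$r(t)=e^{-Ht}\,\mathbb{E}[Z_1Z_{e^t}],\qquad t\in\mathbb{R},$$ be the covariance function $\mathbb{E}[Y_0Y_t]$ of the Lamperti transform $Y_t=e^{-Ht}Z_{e^t}$ of $Z$. Suppose that $r$ is non-negative and decreasing (not necessarily strictly) on $[0,\infty)$, that $r\in L^1(\mathbb{R})$, and that $$\int_0^\infty r(t)\cos(t\lambda)\,dt\ \ge\ \frac{c}{(|\lambda|+1)^{1+2H}}\qquad\text{for all }\lambda\in\mathbb{R}.$$ Then for every integer $m\ge1$ and all times $0<s_1\le\dots\le s_m<t<\infty$, almost surely, $$\operatorname{Var}\bigl(Z_t\mid Z_{s_1},\dots,Z_{s_m}\bigr)\ \ge\ \kappa_H\min_{1\le j\le m}|t-s_j|^{2H}.$$ -/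

import Mathlib

open MeasureTheory ProbabilityTheory
open scoped NNReal

/-- `Z` is self-similar with index `H`: for every `a > 0`, the processes `(Z_{at})_{t ≥ 0}` and
`(a^H Z_t)_{t ≥ 0}` have the same finite-dimensional distributions. -/
def IsSelfSimilar {Ω : Type*} [MeasurableSpace Ω] (Z : ℝ≥0 → Ω → ℝ) (H : ℝ) (P : Measure Ω) :
    Prop :=
  ∀ a : ℝ≥0, 0 < a → ∀ I : Finset ℝ≥0,
    IdentDistrib (fun ω ↦ I.restrict (fun t ↦ Z (a * t) ω))
      (fun ω ↦ I.restrict (fun t ↦ (a : ℝ) ^ H * Z t ω)) P P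

/-- The covariance `r(t) = E[Y_0 Y_t] = e^{-Ht} E[Z_1 Z_{e^t}]`, `t ∈ ℝ`, of the Lamperti transform
`Y_t = e^{-Ht} Z_{e^t}` of `Z`. -/
noncomputable def lampertiCov {Ω : Type*} [MeasurableSpace Ω] (Z : ℝ≥0 → Ω → ℝ) (H : ℝ)
    (P : Measure Ω) (t : ℝ) : ℝ :=
  Real.exp (-H * t) * ∫ ω, Z 1 ω * Z ⟨Real.exp t, (Real.exp_pos t).le⟩ ω ∂P

/-- Strong local nondeterminism with index `H` and constant `κ`: for all `m ≥ 1` and all times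
`0 < s_1 ≤ … ≤ s_m < t`, almost surely
`Var(Z_t | Z_{s_1}, …, Z_{s_m}) ≥ κ min_j |t - s_j|^{2H}`, where the conditional variance is taken
with respect to the σ-algebra generated by the random vector `(Z_{s_1}, …, Z_{s_m})`. -/
def StrongLocalNondeterminismWith {Ω : Type*} [MeasurableSpace Ω] (Z : ℝ≥0 → Ω → ℝ) (H κ : ℝ)
    (P : Measure Ω) : Prop :=
  ∀ m : ℕ, 1 ≤ m → ∀ s : Fin m → ℝ≥0, Monotone s → (∀ j, 0 < s j) →
    ∀ t : ℝ≥0, (∀ j, s j < t) →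
      ∀ᵐ ω ∂P, κ * (⨅ j : Fin m, |(t : ℝ) - (s j : ℝ)| ^ (2 * H)) ≤
        condVar (MeasurableSpace.comap (fun ω' ↦ fun j : Fin m ↦ Z (s j) ω') inferInstance)
          (Z t) P ω

/-! For a Gaussian vector the conditional variance is the constant `E[(Z_t - ∑ aᵢ Z_{sᵢ})²]`, with
`∑ aᵢ Z_{sᵢ}` the orthogonal projection of `Z_t`. Self-similarity gives `E[Z_s Z_t] = s^H t^H r(log
t - log s)`, so in logarithmic time this is a quadratic form `∑ bᵢ bⱼ r(uᵢ - uⱼ)` whose coefficient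
at `t` is `t^H`.

The Fourier transform `g` of `r` is twice the cosine transform, hence bounded below by the
hypothesis. Being non-negative, it is integrable, and Fourier inversion bounds the form below by `∫
g |∑ bᵢ e^{2πi uᵢ ξ}|²` (`integral_mul_norm_trigSum_sq_le`). Only an inequality is available,
because `r` may jump at the origin.

The core is `exists_mul_rpow_le_integral_mul_norm_trigSum_sq`. If `u_{i₀}` is at distance at least
`ε` from the other points, a bump function of width `ε` extracts `b_{i₀}` from the trigonometric
sum. A weighted Cauchy–Schwarz inequality and the decay bound on `g` then give a contribution of
order `ε^{2H} b_{i₀}²`. The gap `ε = 1 - max sⱼ / t` turns this into `(t - max sⱼ)^{2H}`. -/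

/-! ### Fourier inversion for even functions monotone on the half-line -/

open Filter in
open scoped FourierTransform Topology in
/-- A bounded integrable function with non-negative Fourier transform has an integrable Fourier
transform. -/
theorem integrable_of_fourier_eq_ofReal_nonneg {R g : ℝ → ℝ} {M : ℝ} (hR : Integrable R)
    (hM : ∀ x, |R x| ≤ M) (hg : ∀ ξ, 0 ≤ g ξ)
    (hRg : 𝓕 (fun x ↦ (R x : ℂ)) = fun ξ ↦ (g ξ : ℂ)) : Integrable g := by
  have hRc : Integrable (fun x ↦ (R x : ℂ)) := hR.ofReal
  have hcont : Continuous g := by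
    have h1 : Continuous (𝓕 (fun x ↦ (R x : ℂ))) :=
      VectorFourier.fourierIntegral_continuous Real.continuous_fourierChar
        (L := innerₗ ℝ) continuous_inner hRc
    rw [hRg] at h1
    simpa using! Complex.continuous_re.comp h1
  -- Gaussian regularisation: moving the Fourier transform onto the Gaussian turns the integral into
  -- an average of `R` against a probability density, so `M` bounds it uniformly in `b`.
  have key : ∀ b : ℝ, 0 < b → Integrable (fun ξ ↦ Real.exp (-b * ξ ^ 2) * g ξ) ∧
      ∫ ξ, Real.exp (-b * ξ ^ 2) * g ξ ≤ M := by
    intro b hb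
    have hGi : Integrable (fun ξ : ℝ ↦ Real.exp (-b * ξ ^ 2)) := integrable_exp_neg_mul_sq hb
    have hgb : ∀ ξ, ‖g ξ‖ ≤ ∫ x, ‖(R x : ℂ)‖ := by
      intro ξ
      have h2 := congrFun hRg ξ
      have h3 : ‖g ξ‖ = ‖𝓕 (fun x ↦ (R x : ℂ)) ξ‖ := by rw [h2]; simp
      rw [h3]
      exact VectorFourier.norm_fourierIntegral_le_integral_norm _ _ _ _ _
    have hint : Integrable (fun ξ ↦ Real.exp (-b * ξ ^ 2) * g ξ) :=
      hGi.mul_bdd hcont.aestronglyMeasurable (Eventually.of_forall hgb)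
    refine ⟨hint, ?_⟩
    set k : ℝ → ℝ := fun w ↦ (Real.pi / b) ^ (1 / 2 : ℝ) * Real.exp (-(Real.pi ^ 2 / b) * w ^ 2)
      with hk
    have hGk : 𝓕 (fun v : ℝ ↦ Complex.exp (-(b : ℂ) * ‖v‖ ^ 2)) = fun w ↦ (k w : ℂ) := by
      ext w
      rw [fourier_gaussian_innerProductSpace (by simpa using hb)]
      simp only [hk]
      push_cast
      rw [Complex.ofReal_cpow (by positivity)]
      simp only [Module.finrank_self, Real.norm_eq_abs]
      push_cast
      congr 2
      rw [← Complex.ofReal_pow |w|, sq_abs]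
      push_cast
      ring
    have hJ : Integrable (fun v : ℝ ↦ Complex.exp (-(b : ℂ) * ‖v‖ ^ 2)) := by
      simpa using GaussianFourier.integrable_cexp_neg_mul_sq_norm_add (V := ℝ)
        (b := (b : ℂ)) (by simpa using hb) 0 0
    have hsw : ∫ ξ, 𝓕 (fun x ↦ (R x : ℂ)) ξ • Complex.exp (-(b : ℂ) * ‖ξ‖ ^ 2)
        = ∫ x, (R x : ℂ) • 𝓕 (fun v : ℝ ↦ Complex.exp (-(b : ℂ) * ‖v‖ ^ 2)) x := by
      simpa using! (VectorFourier.integral_fourierIntegral_smul_eq_flip (L := innerₗ ℝ)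
        Real.continuous_fourierChar continuous_inner hRc hJ)
    have hreal : ∫ ξ, Real.exp (-b * ξ ^ 2) * g ξ = ∫ x, R x * k x := by
      rw [hGk, hRg] at hsw
      have e1 : ∀ ξ : ℝ, (g ξ : ℂ) • Complex.exp (-(b : ℂ) * ‖ξ‖ ^ 2)
          = ((Real.exp (-b * ξ ^ 2) * g ξ : ℝ) : ℂ) := by
        intro ξ
        push_cast
        rw [smul_eq_mul, mul_comm, Real.norm_eq_abs, ← Complex.ofReal_pow |ξ|, sq_abs]
        push_cast
        ring
      have e2 : ∀ x : ℝ, (R x : ℂ) • (k x : ℂ) = ((R x * k x : ℝ) : ℂ) := by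
        intro x; push_cast; rfl
      simp_rw [e1, e2] at hsw
      rw [integral_complex_ofReal, integral_complex_ofReal] at hsw
      exact_mod_cast hsw
    have hk0 : ∀ x, 0 ≤ k x := fun x ↦ by positivity
    have hki : Integrable k := (integrable_exp_neg_mul_sq (by positivity)).const_mul _
    have hk1 : ∫ x, k x = 1 := by
      simp only [hk]
      rw [integral_const_mul, integral_gaussian, ← Real.sqrt_eq_rpow,
        ← Real.sqrt_mul (by positivity)]
      rw [show Real.pi / b * (Real.pi / (Real.pi ^ 2 / b)) = 1 by
        have := Real.pi_pos; field_simp]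
      simp
    rw [hreal]
    calc ∫ x, R x * k x ≤ ∫ x, M * k x := by
          refine integral_mono ?_ (hki.const_mul _) fun x ↦ ?_
          · exact hki.bdd_mul hR.aestronglyMeasurable
              (Eventually.of_forall fun x ↦ by simpa using hM x)
          · exact mul_le_mul_of_nonneg_right ((le_abs_self _).trans (hM x)) (hk0 x)
      _ = M := by rw [integral_const_mul, hk1, mul_one]
  refine (aecover_Icc (μ := volume) (tendsto_neg_atTop_atBot.comp tendsto_natCast_atTop_atTop)
    (tendsto_natCast_atTop_atTop (R := ℝ)) :
      AECover volume atTop _).integrable_of_integral_bounded_of_nonneg_ae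
    (Real.exp 1 * M) (fun n ↦ hcont.continuousOn.integrableOn_compact isCompact_Icc)
    (Eventually.of_forall hg) ?_
  filter_upwards [eventually_gt_atTop 0] with n hn
  have hn' : (0 : ℝ) < n := by exact_mod_cast hn
  -- With this `b` the Gaussian weight is at least `e⁻¹` on `[-n, n]`.
  obtain ⟨hi, hle⟩ := key (1 / (n : ℝ) ^ 2) (by positivity)
  calc ∫ x in Set.Icc (-(n : ℝ)) n, g x
      ≤ ∫ x in Set.Icc (-(n : ℝ)) n, Real.exp 1 * (Real.exp (-(1 / (n : ℝ) ^ 2) * x ^ 2) * g x) := by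
        refine setIntegral_mono_on (hcont.continuousOn.integrableOn_compact isCompact_Icc)
          (hi.const_mul _).integrableOn measurableSet_Icc fun x hx ↦ ?_
        rw [← mul_assoc, ← Real.exp_add]
        refine le_mul_of_one_le_left (hg x) (Real.one_le_exp ?_)
        have : x ^ 2 ≤ (n : ℝ) ^ 2 := sq_le_sq' hx.1 hx.2
        have : 1 / (n : ℝ) ^ 2 * x ^ 2 ≤ 1 := by
          rw [one_div, inv_mul_le_iff₀ (by positivity)]; linarith
        linarith
    _ ≤ ∫ x, Real.exp 1 * (Real.exp (-(1 / (n : ℝ) ^ 2) * x ^ 2) * g x) :=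
        setIntegral_le_integral (hi.const_mul _)
          (Eventually.of_forall fun x ↦ mul_nonneg (Real.exp_pos _).le
            (mul_nonneg (Real.exp_pos _).le (hg x)))
    _ ≤ Real.exp 1 * M := by
        rw [integral_const_mul]
        exact mul_le_mul_of_nonneg_left hle (Real.exp_pos _).le

open scoped FourierTransform in
/-- The Fourier transform of an even real function is its cosine transform. -/
theorem fourier_ofReal_of_even {R : ℝ → ℝ} (hR : Integrable R) (heven : ∀ x, R (-x) = R x) :
    𝓕 (fun x ↦ (R x : ℂ)) =
      fun ξ ↦ ((2 * ∫ x in Set.Ioi (0 : ℝ), R x * Real.cos (x * (2 * Real.pi * ξ)) : ℝ) : ℂ) := by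
  ext ξ
  have hc : Integrable (fun x ↦ R x * Real.cos (x * (2 * Real.pi * ξ))) :=
    hR.mul_bdd (by fun_prop) (.of_forall fun x ↦ Real.abs_cos_le_one _)
  have hs : Integrable (fun x ↦ R x * Real.sin (x * (2 * Real.pi * ξ))) :=
    hR.mul_bdd (by fun_prop) (.of_forall fun x ↦ Real.abs_sin_le_one _)
  have hcos : ∫ x, R x * Real.cos (x * (2 * Real.pi * ξ))
      = 2 * ∫ x in Set.Ioi (0 : ℝ), R x * Real.cos (x * (2 * Real.pi * ξ)) := by
    rw [← integral_comp_abs (f := fun x ↦ R x * Real.cos (x * (2 * Real.pi * ξ)))]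
    refine integral_congr_ae (.of_forall fun x ↦ ?_)
    rcases abs_choice x with h | h <;> simp only [h, heven, neg_mul, Real.cos_neg]
  have hsin : ∫ x, R x * Real.sin (x * (2 * Real.pi * ξ)) = 0 := by
    have h := integral_neg_eq_self (fun x ↦ R x * Real.sin (x * (2 * Real.pi * ξ))) volume
    simp only [heven, neg_mul, Real.sin_neg, mul_neg, integral_neg] at h
    linarith
  rw [Real.fourier_real_eq_integral_exp_smul, ← hcos]
  have e : ∀ x : ℝ, Complex.exp (↑(-2 * Real.pi * x * ξ) * Complex.I) • (R x : ℂ)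
      = ((R x * Real.cos (x * (2 * Real.pi * ξ)) : ℝ) : ℂ)
        - Complex.I * ((R x * Real.sin (x * (2 * Real.pi * ξ)) : ℝ) : ℂ) := by
    intro x
    rw [show -2 * Real.pi * x * ξ = -(x * (2 * Real.pi * ξ)) by ring, Complex.exp_mul_I,
      ← Complex.ofReal_cos, ← Complex.ofReal_sin, Real.cos_neg, Real.sin_neg, smul_eq_mul]
    push_cast
    ring
  simp_rw [e]
  rw [integral_sub hc.ofReal (hs.ofReal.const_mul _), integral_const_mul,
    integral_complex_ofReal, integral_complex_ofReal, hsin]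
  simp

open Filter in
open scoped FourierTransform Topology in
/-- Fourier inversion for an even function, monotone on the half-line, with non-negative
Fourier transform: it holds off the origin, where an inequality is left. -/
theorem fourier_inversion_of_antitoneOn {R g : ℝ → ℝ} (hR : Integrable R)
    (heven : ∀ x, R (-x) = R x) (hanti : AntitoneOn R (Set.Ici 0))
    (hg : Integrable g) (hRg : 𝓕 (fun x ↦ (R x : ℂ)) = fun ξ ↦ (g ξ : ℂ)) :
    (∀ x, x ≠ 0 → R x = ∫ ξ, g ξ * Real.cos (2 * Real.pi * x * ξ)) ∧
      ∫ ξ, g ξ * Real.cos (2 * Real.pi * 0 * ξ) ≤ R 0 := by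
  set S : ℝ → ℝ := fun x ↦ ∫ ξ, g ξ * Real.cos (2 * Real.pi * x * ξ) with hS
  have hScont : Continuous S := by
    refine continuous_of_dominated (bound := fun ξ ↦ ‖g ξ‖) (fun x ↦ ?_) (fun x ↦ ?_) hg.norm ?_
    · exact hg.aestronglyMeasurable.mul (by fun_prop)
    · refine .of_forall fun ξ ↦ ?_
      rw [norm_mul]
      exact mul_le_of_le_one_right (norm_nonneg _) (Real.abs_cos_le_one _)
    · exact .of_forall fun ξ ↦ by fun_prop
  -- Freezing `R` at `R 0` on the negative axis gives a function antitone on all of `ℝ`, hence with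
  -- countably many discontinuities.
  set D : Set ℝ := {x | ¬ ContinuousAt (fun y ↦ R (max y 0)) x}
  have hD : D.Countable := by
    refine Antitone.countable_not_continuousAt fun x y hxy ↦ ?_
    exact hanti (Set.mem_Ici.mpr (le_max_right x 0)) (Set.mem_Ici.mpr (le_max_right y 0))
      (max_le_max_right _ hxy)
  have hpt : ∀ x, 0 < x → x ∉ D → R x = S x := by
    intro x hx hxD
    have hc : ContinuousAt (fun y ↦ R (max y 0)) x := not_not.mp hxD
    have hc' : ContinuousAt (fun y ↦ (R y : ℂ)) x := by
      refine Complex.continuous_ofReal.continuousAt.comp (hc.congr ?_)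
      filter_upwards [lt_mem_nhds hx] with y hy
      rw [max_eq_left hy.le]
    have h := hR.ofReal.fourierInv_fourier_eq (f := fun y ↦ (R y : ℂ))
      (by rw [hRg]; exact hg.ofReal) hc'
    rw [hRg, Real.fourierInv_eq'] at h
    have hi : Integrable (fun ξ : ℝ ↦
        Complex.exp (((2 * Real.pi * inner ℝ ξ x : ℝ) : ℂ) * Complex.I) • (g ξ : ℂ)) := by
      refine hg.ofReal.bdd_mul (c := 1) (by fun_prop) (.of_forall fun ξ ↦ ?_)
      rw [Complex.norm_exp_ofReal_mul_I]
    have h2 := congrArg Complex.re h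
    rw [Complex.ofReal_re, ← RCLike.re_eq_complex_re, ← integral_re hi] at h2
    rw [← h2]
    refine integral_congr_ae (.of_forall fun ξ ↦ ?_)
    simp only [RCLike.re_eq_complex_re, smul_eq_mul, Complex.re_mul_ofReal,
      Complex.exp_ofReal_mul_I_re, RCLike.inner_apply, conj_trivial]
    rw [mul_comm, mul_assoc _ x ξ]
  have hdense : ∀ a b : ℝ, 0 ≤ a → a < b → ∃ y, a < y ∧ y < b ∧ R y = S y := by
    intro a b ha hab
    obtain ⟨y, hy1, hy2⟩ := hD.dense_compl ℝ |>.exists_between hab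
    exact ⟨y, hy2.1, hy2.2, hpt y (ha.trans_lt hy2.1) hy1⟩
  -- Continuity points approach `x` from the right here, which allows `x = 0`; the reverse bound
  -- approaches from the left and needs `0 < x`.
  have hupper : ∀ x, 0 ≤ x → S x ≤ R x := by
    intro x hx
    refine le_of_forall_pos_le_add fun e he ↦ ?_
    obtain ⟨d, hd, hd'⟩ := Metric.continuous_iff.mp hScont x e he
    obtain ⟨y, h1, h2, h3⟩ := hdense x (x + d) hx (by linarith)
    have h4 := hd' y (by rw [Real.dist_eq, abs_of_pos] <;> linarith)
    rw [Real.dist_eq, abs_lt] at h4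
    have h5 : R y ≤ R x := hanti hx (hx.trans h1.le) h1.le
    linarith [h4.1]
  have hlower : ∀ x, 0 < x → R x ≤ S x := by
    intro x hx
    refine le_of_forall_pos_le_add fun e he ↦ ?_
    obtain ⟨d, hd, hd'⟩ := Metric.continuous_iff.mp hScont x e he
    obtain ⟨y, h1, h2, h3⟩ := hdense (max 0 (x - d)) x (le_max_left _ _) (max_lt hx (by linarith))
    have h6 : x - d < y := (le_max_right _ _).trans_lt h1
    have h7 : 0 < y := (le_max_left _ _).trans_lt h1
    have h4 := hd' y (by rw [Real.dist_eq, abs_of_neg] <;> linarith)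
    rw [Real.dist_eq, abs_lt] at h4
    have h5 : R x ≤ R y := hanti h7.le hx.le h2.le
    linarith [h4.2]
  have hpos : ∀ x, 0 < x → R x = S x := fun x hx ↦ le_antisymm (hlower x hx) (hupper x hx.le)
  refine ⟨fun x hx ↦ ?_, hupper 0 le_rfl⟩
  rcases lt_or_gt_of_ne hx with h | h
  · rw [← heven, hpos (-x) (by linarith)]
    simp [hS]
  · exact hpos x h

/-! ### Conditional variance of Gaussian processes -/

open scoped ENNReal in
/-- Least squares: an `L²` random variable is a linear combination of finitely many given ones, up
to a remainder orthogonal to all of them. -/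
theorem exists_linear_combination_orthogonal {Ω ι : Type*} [Fintype ι] [MeasurableSpace Ω]
    {P : Measure Ω} {X : Ω → ℝ} {V : ι → Ω → ℝ} (hX : MemLp X 2 P) (hV : ∀ i, MemLp (V i) 2 P) :
    ∃ a : ι → ℝ, ∀ j, ∫ ω, (X ω - ∑ i, a i * V i ω) * V j ω ∂P = 0 := by
  classical
  set v : ι → Lp ℝ 2 P := fun i ↦ (hV i).toLp (V i)
  set x : Lp ℝ 2 P := hX.toLp X
  set U : Submodule ℝ (Lp ℝ 2 P) := Submodule.span ℝ (Set.range v)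
  have hfin : FiniteDimensional ℝ U := FiniteDimensional.span_of_finite ℝ (Set.finite_range v)
  obtain ⟨a, ha⟩ := (Submodule.mem_span_range_iff_exists_fun ℝ).mp (U.starProjection_apply_mem x)
  refine ⟨a, fun j ↦ ?_⟩
  have h := U.starProjection_inner_eq_zero x (v j) (Submodule.subset_span ⟨j, rfl⟩)
  rw [← ha, L2.inner_def] at h
  rw [← h]
  refine integral_congr_ae ?_
  have h1 : ∀ᵐ ω ∂P, ∀ i, v i ω = V i ω := ae_all_iff.mpr fun i ↦ (hV i).coeFn_toLp
  have h2 : ∀ᵐ ω ∂P, ∀ i, (a i • v i) ω = a i * v i ω := ae_all_iff.mpr fun i ↦ by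
    filter_upwards [Lp.coeFn_smul (a i) (v i)] with ω hω
    simpa using hω
  filter_upwards [h1, h2, hX.coeFn_toLp, Lp.coeFn_sub x (∑ i, a i • v i),
    Lp.coeFn_finsetSum Finset.univ (fun i ↦ a i • v i)] with ω h1 h2 h3 h4 h5
  rw [h4, Pi.sub_apply, h5, h1]
  simp only [Finset.sum_apply, h2, h1, RCLike.inner_apply, conj_trivial]
  rw [h3, mul_comm]

/-- For a centered Gaussian process, the conditional variance given finitely many values is the
constant squared distance to some linear combination of these values. -/
theorem ProbabilityTheory.IsGaussianProcess.exists_condVar_ae_eq {Ω T ι : Type*} [Fintype ι] [MeasurableSpace Ω]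
    {P : Measure Ω} [IsProbabilityMeasure P] {Z : T → Ω → ℝ} (hZm : ∀ t, Measurable (Z t))
    (hZ : IsGaussianProcess Z P) (hZ0 : ∀ t, ∫ ω, Z t ω ∂P = 0) (t : T) (s : ι → T) :
    ∃ a : ι → ℝ, condVar (MeasurableSpace.comap (fun ω ↦ fun j ↦ Z (s j) ω) inferInstance) (Z t) P
      =ᵐ[P] fun _ ↦ ∫ ω, (Z t ω - ∑ i, a i * Z (s i) ω) ^ 2 ∂P := by
  classical
  have hL2 : ∀ t, MemLp (Z t) 2 P := fun t ↦ (hZ.hasGaussianLaw_eval t).memLp_two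
  obtain ⟨a, ha⟩ := exists_linear_combination_orthogonal (hL2 t) (fun i ↦ hL2 (s i))
  refine ⟨a, ?_⟩
  set W : Ω → ι → ℝ := fun ω j ↦ Z (s j) ω with hW
  have hWm : Measurable W := measurable_pi_lambda _ fun j ↦ hZm (s j)
  have hmle := hWm.comap_le
  set A : Ω → ℝ := fun ω ↦ ∑ i, a i * Z (s i) ω with hA
  set R : Ω → ℝ := fun ω ↦ Z t ω - A ω with hR
  have hAL2 : MemLp A 2 P := memLp_finsetSum _ fun i _ ↦ (hL2 (s i)).const_mul (a i)
  have hRL2 : MemLp R 2 P := (hL2 t).sub hAL2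
  have hA0 : ∫ ω, A ω ∂P = 0 := by
    simp only [hA]
    rw [integral_finsetSum _ fun i _ ↦ ((hL2 (s i)).integrable one_le_two).const_mul _]
    simp [integral_const_mul, hZ0]
  have hR0 : ∫ ω, R ω ∂P = 0 := by
    simp only [hR]
    rw [integral_sub ((hL2 t).integrable one_le_two) (hAL2.integrable one_le_two), hZ0, hA0,
      sub_zero]
  have hRm : Measurable R := (hZm t).sub (Finset.measurable_fun_sum _ fun i _ ↦
    (hZm (s i)).const_mul _)
  have hAm : Measurable[MeasurableSpace.comap W inferInstance] A := by
    have h1 : Measurable (fun x : ι → ℝ ↦ ∑ i, a i * x i) := by fun_prop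
    exact h1.comp (comap_measurable W)
  -- The residual is jointly Gaussian with the conditioning variables, so orthogonality upgrades to
  -- independence.
  have hproc : IsGaussianProcess
      (Sum.elim (fun (_ : Unit) ω ↦ R ω) (fun (i : ι) ω ↦ Z (s i) ω)) P := by
    refine hZ.of_isGaussianProcess fun k ↦ ?_
    refine ⟨insert t (Finset.univ.image s), ?_⟩
    let pr : T → ((insert t (Finset.univ.image s) : Finset T) → ℝ) →L[ℝ] ℝ := fun u ↦
      if h : u ∈ insert t (Finset.univ.image s) then ContinuousLinearMap.proj ⟨u, h⟩ else 0
    have hpt : ∀ ω, pr t ((insert t (Finset.univ.image s)).restrict (Z · ω)) = Z t ω := fun ω ↦ by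
      simp [pr]
    have hps : ∀ i ω, pr (s i) ((insert t (Finset.univ.image s)).restrict (Z · ω)) = Z (s i) ω :=
      fun i ω ↦ by simp [pr]
    rcases k with _ | i
    · refine ⟨pr t - ∑ i, a i • pr (s i), fun ω ↦ ?_⟩
      simp [hpt, hps, hR, hA]
    · exact ⟨pr (s i), fun ω ↦ by simp [hps]⟩
  have hind : IndepFun (fun ω (_ : Unit) ↦ R ω) (fun ω i ↦ Z (s i) ω) P := by
    refine hproc.indepFun_of_covariance_eq_zero (fun _ ↦ hRm.aemeasurable)
      (fun i ↦ (hZm _).aemeasurable) fun _ j ↦ ?_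
    rw [covariance_eq_sub hRL2 (hL2 _)]
    have := ha j
    simp only [Pi.mul_apply, hR0, hZ0, mul_zero, sub_zero]
    exact this
  have hindR : IndepFun R W P := hind.comp (φ := fun f : Unit → ℝ ↦ f ()) (ψ := id)
    (measurable_pi_apply _) measurable_id
  have hcond : P[Z t | MeasurableSpace.comap W inferInstance] =ᵐ[P] A := by
    have h1 : P[R | MeasurableSpace.comap W inferInstance] =ᵐ[P] fun _ ↦ ∫ ω, R ω ∂P :=
      condExp_indep_eq hRm.comap_le hmle
        (comap_measurable R).stronglyMeasurable hindR
    have h2 : P[A | MeasurableSpace.comap W inferInstance] = A := condExp_of_stronglyMeasurable hmle hAm.stronglyMeasurable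
      (hAL2.integrable one_le_two)
    have h3 : Z t = A + R := by ext ω; simp [hR]
    have h4 := condExp_add (hAL2.integrable one_le_two) (hRL2.integrable one_le_two)
      (MeasurableSpace.comap W inferInstance) (μ := P)
    rw [← h3, h2] at h4
    filter_upwards [h1, h4] with ω h1 h4
    rw [h4, Pi.add_apply, h1, hR0, add_zero]
  have hsq : P[fun ω ↦ R ω ^ 2 | MeasurableSpace.comap W inferInstance] =ᵐ[P] fun _ ↦ ∫ ω, R ω ^ 2 ∂P :=
    condExp_indep_eq hRm.comap_le hmle
      ((comap_measurable R).pow_const 2).stronglyMeasurable hindR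
  refine Filter.EventuallyEq.trans (condExp_congr_ae ?_) hsq
  filter_upwards [hcond] with ω h
  simp only [Pi.pow_apply, Pi.sub_apply, h, hR]

/-! ### Self-similarity and the Lamperti covariance -/

/-- The covariance of a self-similar process through that of its Lamperti transform. -/
theorem IsSelfSimilar.integral_mul {Ω : Type*} [MeasurableSpace Ω] {P : Measure Ω}
    {Z : ℝ≥0 → Ω → ℝ} {H : ℝ} (hZ : IsSelfSimilar Z H P) {a : ℝ≥0} (ha : 0 < a) (s t : ℝ≥0) :
    ∫ ω, Z (a * s) ω * Z (a * t) ω ∂P = (a : ℝ) ^ H * (a : ℝ) ^ H * ∫ ω, Z s ω * Z t ω ∂P := by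
  have hm : Measurable fun f : ({s, t} : Finset ℝ≥0) → ℝ ↦
      f ⟨s, by simp⟩ * f ⟨t, by simp⟩ :=
    (measurable_pi_apply (⟨s, by simp⟩ : ({s, t} : Finset ℝ≥0))).mul
      (measurable_pi_apply (⟨t, by simp⟩ : ({s, t} : Finset ℝ≥0)))
  have h := (hZ a ha {s, t}).comp hm
  have h := h.integral_eq
  simp only [Function.comp_def, Finset.restrict] at h
  rw [h, ← integral_const_mul]
  congr with ω
  ring

theorem lampertiCov_of_coe_eq_exp {Ω : Type*} [MeasurableSpace Ω] {P : Measure Ω}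
    {Z : ℝ≥0 → Ω → ℝ} {H x : ℝ} {q : ℝ≥0} (hq : (q : ℝ) = Real.exp x) :
    lampertiCov Z H P x = Real.exp (-H * x) * ∫ ω, Z 1 ω * Z q ω ∂P := by
  obtain rfl : q = ⟨Real.exp x, (Real.exp_pos x).le⟩ := NNReal.eq hq
  rfl

/-- Scaling by `s` reduces the pair of times to `1` and `t / s = e^{log t - log s}`. -/
theorem IsSelfSimilar.integral_mul_eq_lampertiCov {Ω : Type*} [MeasurableSpace Ω] {P : Measure Ω}
    {Z : ℝ≥0 → Ω → ℝ} {H : ℝ} (hZ : IsSelfSimilar Z H P) {s t : ℝ≥0} (hs : 0 < s) (ht : 0 < t) :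
    ∫ ω, Z s ω * Z t ω ∂P
      = (s : ℝ) ^ H * (t : ℝ) ^ H * lampertiCov Z H P (Real.log t - Real.log s) := by
  have hs' : (0 : ℝ) < s := hs
  have ht' : (0 : ℝ) < t := ht
  have h := hZ.integral_mul hs 1 (t / s)
  have hq : ((t / s : ℝ≥0) : ℝ) = Real.exp (Real.log t - Real.log s) := by
    rw [NNReal.coe_div, Real.exp_sub, Real.exp_log hs', Real.exp_log ht']
  rw [mul_div_cancel₀ t hs.ne', mul_one] at h
  rw [h, lampertiCov_of_coe_eq_exp hq, ← mul_assoc]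
  congr 1
  rw [mul_assoc]
  congr 1
  rw [Real.rpow_def_of_pos hs', Real.rpow_def_of_pos ht', ← Real.exp_add]
  congr 1
  ring

theorem IsSelfSimilar.lampertiCov_neg {Ω : Type*} [MeasurableSpace Ω] {P : Measure Ω}
    {Z : ℝ≥0 → Ω → ℝ} {H : ℝ} (hZ : IsSelfSimilar Z H P) (x : ℝ) :
    lampertiCov Z H P (-x) = lampertiCov Z H P x := by
  obtain ⟨s, hs⟩ : ∃ s : ℝ≥0, (s : ℝ) = Real.exp x := ⟨⟨_, (Real.exp_pos x).le⟩, rfl⟩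
  have hs0 : 0 < s := by rw [← NNReal.coe_pos, hs]; exact Real.exp_pos x
  have h1 := hZ.integral_mul_eq_lampertiCov hs0 one_pos
  have h2 := hZ.integral_mul_eq_lampertiCov one_pos hs0
  simp_rw [mul_comm (Z s _)] at h1
  rw [h1] at h2
  simp only [NNReal.coe_one, Real.log_one, zero_sub, sub_zero, Real.one_rpow, one_mul, mul_one, hs,
    Real.log_exp] at h2
  exact mul_left_cancel₀ (Real.rpow_pos_of_pos (Real.exp_pos x) H).ne' h2

/-! ### Trigonometric sums and quadratic forms -/

/-- The trigonometric sum `∑ᵢ bᵢ e^{2π i uᵢ ξ}`. -/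
noncomputable def trigSum {ι : Type*} [Fintype ι] (u b : ι → ℝ) (ξ : ℝ) : ℂ :=
  ∑ i, (b i : ℂ) * Complex.exp ((2 * Real.pi * u i * ξ : ℝ) * Complex.I)

theorem continuous_trigSum {ι : Type*} [Fintype ι] (u b : ι → ℝ) : Continuous (trigSum u b) := by
  unfold trigSum
  fun_prop

theorem norm_trigSum_le {ι : Type*} [Fintype ι] (u b : ι → ℝ) (ξ : ℝ) :
    ‖trigSum u b ξ‖ ≤ ∑ i, |b i| := by
  refine (norm_sum_le _ _).trans (Finset.sum_le_sum fun i _ ↦ ?_)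
  rw [norm_mul, Complex.norm_exp_ofReal_mul_I]
  simp

theorem norm_trigSum_sq {ι : Type*} [Fintype ι] (u b : ι → ℝ) (ξ : ℝ) :
    ‖trigSum u b ξ‖ ^ 2
      = ∑ i, ∑ j, b i * b j * Real.cos (2 * Real.pi * (u i - u j) * ξ) := by
  have hre : (trigSum u b ξ).re = ∑ i, b i * Real.cos (2 * Real.pi * u i * ξ) := by
    simp only [trigSum, Complex.re_sum, Complex.re_ofReal_mul, Complex.exp_ofReal_mul_I_re]
  have him : (trigSum u b ξ).im = ∑ i, b i * Real.sin (2 * Real.pi * u i * ξ) := by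
    simp only [trigSum, Complex.im_sum, Complex.im_ofReal_mul, Complex.exp_ofReal_mul_I_im]
  rw [Complex.sq_norm, Complex.normSq_apply, hre, him, Finset.sum_mul_sum, Finset.sum_mul_sum,
    ← Finset.sum_add_distrib]
  refine Finset.sum_congr rfl fun i _ ↦ ?_
  rw [← Finset.sum_add_distrib]
  refine Finset.sum_congr rfl fun j _ ↦ ?_
  rw [show 2 * Real.pi * (u i - u j) * ξ = 2 * Real.pi * u i * ξ - 2 * Real.pi * u j * ξ by ring,
    Real.cos_sub]
  ring

theorem integrable_mul_norm_trigSum_sq {ι : Type*} [Fintype ι] {g : ℝ → ℝ} (hg : Integrable g)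
    (u b : ι → ℝ) : Integrable fun ξ ↦ g ξ * ‖trigSum u b ξ‖ ^ 2 := by
  refine hg.mul_bdd (c := (∑ i, |b i|) ^ 2)
    ((continuous_trigSum u b).norm.pow 2).aestronglyMeasurable (.of_forall fun ξ ↦ ?_)
  rw [norm_pow, norm_norm]
  exact pow_le_pow_left₀ (norm_nonneg _) (norm_trigSum_le u b ξ) 2

/-- If `R` is the cosine transform of `g` off the origin, and dominates it at the origin, then its
quadratic forms dominate the spectral ones. -/
theorem integral_mul_norm_trigSum_sq_le {ι : Type*} [Fintype ι] {R g : ℝ → ℝ} (hg : Integrable g)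
    (hR : ∀ x, x ≠ 0 → R x = ∫ ξ, g ξ * Real.cos (2 * Real.pi * x * ξ))
    (hR0 : ∫ ξ, g ξ * Real.cos (2 * Real.pi * 0 * ξ) ≤ R 0) (u b : ι → ℝ) :
    ∫ ξ, g ξ * ‖trigSum u b ξ‖ ^ 2 ≤ ∑ i, ∑ j, b i * b j * R (u i - u j) := by
  classical
  set S : ℝ → ℝ := fun x ↦ ∫ ξ, g ξ * Real.cos (2 * Real.pi * x * ξ)
  have hi : ∀ x, Integrable fun ξ ↦ g ξ * Real.cos (2 * Real.pi * x * ξ) := fun x ↦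
    hg.mul_bdd (by fun_prop) (.of_forall fun x ↦ Real.abs_cos_le_one _)
  have h1 : ∫ ξ, g ξ * ‖trigSum u b ξ‖ ^ 2 = ∑ i, ∑ j, b i * b j * S (u i - u j) := by
    simp_rw [norm_trigSum_sq, Finset.mul_sum, mul_left_comm (g _)]
    rw [integral_finsetSum _ fun i _ ↦ integrable_finsetSum _ fun j _ ↦ (hi _).const_mul _]
    refine Finset.sum_congr rfl fun i _ ↦ ?_
    rw [integral_finsetSum _ fun j _ ↦ (hi _).const_mul _]
    exact Finset.sum_congr rfl fun j _ ↦ integral_const_mul _ _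
  -- The jump at the origin adds a multiple of the form with kernel `1_{x = 0}`. The points `u i`
  -- may coincide, and grouping equal ones shows this form is a sum of squares.
  have h2 : ∀ x, R x = S x + (R 0 - S 0) * if x = 0 then 1 else 0 := by
    intro x
    split_ifs with h
    · rw [h]; ring
    · rw [hR x h]; ring
  have h3 : ∑ i, ∑ j, b i * b j * (if u i - u j = 0 then (1 : ℝ) else 0)
      = ∑ v ∈ Finset.univ.image u, (∑ i with u i = v, b i) ^ 2 := by
    rw [← Finset.sum_fiberwise_of_maps_to (s := Finset.univ) (t := Finset.univ.image u)
      (g := u) (fun i _ ↦ Finset.mem_image_of_mem _ (Finset.mem_univ _))]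
    refine Finset.sum_congr rfl fun v _ ↦ ?_
    rw [sq, Finset.sum_mul_sum]
    refine Finset.sum_congr rfl fun i hi ↦ ?_
    rw [Finset.sum_filter]
    refine Finset.sum_congr rfl fun j _ ↦ ?_
    simp only [(Finset.mem_filter.mp hi).2, sub_eq_zero]
    by_cases h : u j = v
    · simp [h]
    · simp [h, Ne.symm h]
  have h4 : ∑ i, ∑ j, b i * b j * R (u i - u j) = (∑ i, ∑ j, b i * b j * S (u i - u j))
      + (R 0 - S 0) * ∑ i, ∑ j, b i * b j * (if u i - u j = 0 then (1 : ℝ) else 0) := by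
    simp_rw [h2 (u _ - u _), Finset.mul_sum, ← Finset.sum_add_distrib]
    refine Finset.sum_congr rfl fun i _ ↦ Finset.sum_congr rfl fun j _ ↦ ?_
    ring
  rw [h1, h4, h3]
  exact le_add_of_nonneg_right (mul_nonneg (sub_nonneg.mpr hR0)
    (Finset.sum_nonneg fun v _ ↦ sq_nonneg _))

/-! ### Isolating one frequency -/

open scoped FourierTransform SchwartzMap in
/-- There is a Schwartz function whose inverse Fourier transform is `1` at the origin and vanishes
outside the unit interval. -/
theorem exists_schwartz_integral_exp_eq :
    ∃ ψ : 𝓢(ℝ, ℂ), ∫ ξ, Complex.exp ((2 * Real.pi * 0 * ξ : ℝ) * Complex.I) * ψ ξ = 1 ∧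
      ∀ x : ℝ, 1 ≤ |x| → ∫ ξ, Complex.exp ((2 * Real.pi * x * ξ : ℝ) * Complex.I) * ψ ξ = 0 := by
  let f : ContDiffBump (0 : ℝ) := ⟨1 / 2, 1, by norm_num, by norm_num⟩
  have hf1 : HasCompactSupport (fun x : ℝ ↦ (f x : ℂ)) :=
    f.hasCompactSupport.comp_left (g := fun x : ℝ ↦ (x : ℂ)) Complex.ofReal_zero
  let φ : 𝓢(ℝ, ℂ) := hf1.toSchwartzMap (Complex.ofRealCLM.contDiff.comp f.contDiff)
  have hφ : ∀ x, φ x = (f x : ℂ) := fun x ↦ rfl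
  have key : ∀ x : ℝ, ∫ ξ, Complex.exp ((2 * Real.pi * x * ξ : ℝ) * Complex.I) * (𝓕 φ) ξ
      = (f x : ℂ) := by
    intro x
    have h : (𝓕⁻ (𝓕 φ)) x = φ x := by rw [FourierTransform.fourierInv_fourier_eq]
    rw [SchwartzMap.fourierInv_coe, Real.fourierInv_eq'] at h
    rw [← hφ, ← h]
    refine integral_congr_ae (.of_forall fun ξ ↦ ?_)
    simp only [smul_eq_mul, RCLike.inner_apply, conj_trivial, mul_assoc]
  refine ⟨𝓕 φ, ?_, fun x hx ↦ ?_⟩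
  · rw [key, f.one_of_mem_closedBall (by simp [f])]
    simp
  · rw [key, f.zero_of_le_dist (by simpa [f, Real.dist_eq] using hx)]
    simp

open scoped SchwartzMap in
-- The cube serves as a weight dominating the power `1 + 2H < 3` for every `H < 1`.
theorem SchwartzMap.integrable_norm_sq_mul_cube (ψ : 𝓢(ℝ, ℂ)) (a : ℝ) :
    Integrable fun ξ ↦ ‖ψ ξ‖ ^ 2 * (a * |ξ| + 1) ^ 3 := by
  obtain ⟨C, hC⟩ : ∃ C, ∀ ξ, ‖ψ ξ‖ ≤ C := ⟨_, SchwartzMap.norm_le_seminorm ℝ ψ⟩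
  have h : ∀ k : ℕ, Integrable fun ξ ↦ ‖ξ‖ ^ k * ‖ψ ξ‖ := fun k ↦ ψ.integrable_pow_mul volume k
  have h1 := ((((h 3).const_mul (a ^ 3)).add ((h 2).const_mul (3 * a ^ 2))).add
    ((h 1).const_mul (3 * a))).add (h 0)
  refine (h1.mul_bdd (c := C) ψ.continuous.norm.aestronglyMeasurable
    (.of_forall fun ξ ↦ by simpa using hC ξ)).congr (.of_forall fun ξ ↦ ?_)
  simp only [Pi.add_apply, Real.norm_eq_abs]
  ring

/-- A spectral density decaying at most like `|ξ|^{-(1+2H)}` is locally nondeterministic: a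
frequency isolated by `ε` contributes at least of the order `ε^{2H}`. -/
theorem exists_mul_rpow_le_integral_mul_norm_trigSum_sq (H : ℝ) (hH0 : 0 < H) (hH1 : H < 1) (c : ℝ)
    (hc : 0 < c) :
    ∃ κ : ℝ, 0 < κ ∧ ∀ g : ℝ → ℝ, Integrable g →
      (∀ ξ, c / (|2 * Real.pi * ξ| + 1) ^ (1 + 2 * H) ≤ g ξ) →
      ∀ {ι : Type} [Fintype ι] (u b : ι → ℝ) (i₀ : ι) (ε : ℝ), 0 < ε → ε ≤ 1 →
        (∀ i, i ≠ i₀ → ε ≤ |u i - u i₀|) →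
        κ * (ε ^ (2 * H) * b i₀ ^ 2) ≤ ∫ ξ, g ξ * ‖trigSum u b ξ‖ ^ 2 := by
  classical
  classical
  obtain ⟨ψ, hψ0, hψ1⟩ := exists_schwartz_integral_exp_eq
  set T : ℝ → ℝ := fun ξ ↦ ‖ψ ξ‖ ^ 2 * (2 * Real.pi * |ξ| + 1) ^ 3 with hT
  have hTi : Integrable T := ψ.integrable_norm_sq_mul_cube _
  have hT0 : 0 ≤ ∫ ξ, T ξ := integral_nonneg fun ξ ↦ by positivity
  -- The summand `1` makes `A` positive without showing that `∫ T` is.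
  set A : ℝ := (∫ ξ, T ξ) / c + 1 with hA
  have hA0 : 0 < A := by positivity
  refine ⟨A⁻¹, by positivity, fun g hg hgc ι _ u b i₀ ε hε hε1 hu ↦ ?_⟩
  set Q : ℝ := ∫ ξ, g ξ * ‖trigSum u b ξ‖ ^ 2 with hQ
  have hg0 : ∀ ξ, 0 ≤ g ξ := fun ξ ↦ le_trans (by positivity) (hgc ξ)
  have hQ0 : 0 ≤ Q := integral_nonneg fun ξ ↦ mul_nonneg (hg0 ξ) (by positivity)
  rcases eq_or_ne (b i₀) 0 with hb | hb
  · simpa [hb] using hQ0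
  set E : ℝ := ε ^ (2 * H) with hE
  have hE0 : 0 < E := Real.rpow_pos_of_pos hε _
  have hψi : Integrable ψ := ψ.integrable
  -- This is `b i₀ = ∑ bᵢ φ((uᵢ - u_{i₀}) / ε)`, where `φ`, the inverse transform of `ψ`, is `1` at
  -- the origin and kills every other index by the gap.
  have hrep : (b i₀ : ℂ) = ∫ ξ, Complex.exp ((-(2 * Real.pi * u i₀ * (ξ / ε)) : ℝ) * Complex.I)
      * (trigSum u b (ξ / ε) * ψ ξ) := by
    have hterm : ∀ i, ∫ ξ, (b i : ℂ) *
        (Complex.exp ((2 * Real.pi * ((u i - u i₀) / ε) * ξ : ℝ) * Complex.I) * ψ ξ)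
        = if i = i₀ then (b i₀ : ℂ) else 0 := by
      intro i
      rw [integral_const_mul]
      split_ifs with h
      · rw [h, sub_self, zero_div, hψ0, mul_one]
      · rw [hψ1, mul_zero]
        rw [abs_div, abs_of_pos hε, le_div_iff₀ hε, one_mul]
        exact hu i h
    have hint : ∀ i, Integrable fun ξ ↦ (b i : ℂ) *
        (Complex.exp ((2 * Real.pi * ((u i - u i₀) / ε) * ξ : ℝ) * Complex.I) * ψ ξ) := fun i ↦
      (hψi.bdd_mul (c := 1) (by fun_prop) (.of_forall fun ξ ↦ by
        rw [Complex.norm_exp_ofReal_mul_I])).const_mul _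
    calc (b i₀ : ℂ) = ∑ i, if i = i₀ then (b i₀ : ℂ) else 0 := by simp
      _ = ∑ i, ∫ ξ, (b i : ℂ) *
          (Complex.exp ((2 * Real.pi * ((u i - u i₀) / ε) * ξ : ℝ) * Complex.I) * ψ ξ) :=
        Finset.sum_congr rfl fun i _ ↦ (hterm i).symm
      _ = _ := by
        rw [← integral_finsetSum _ fun i _ ↦ hint i]
        refine integral_congr_ae (.of_forall fun ξ ↦ ?_)
        simp only [trigSum, Finset.sum_mul, Finset.mul_sum]
        refine Finset.sum_congr rfl fun i _ ↦ ?_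
        have e : Complex.exp ((2 * Real.pi * ((u i - u i₀) / ε) * ξ : ℝ) * Complex.I)
            = Complex.exp ((-(2 * Real.pi * u i₀ * (ξ / ε)) : ℝ) * Complex.I)
              * Complex.exp ((2 * Real.pi * u i * (ξ / ε) : ℝ) * Complex.I) := by
          rw [← Complex.exp_add, ← add_mul, ← Complex.ofReal_add]
          congr 3
          ring
        rw [e]
        ring
  have hbound : |b i₀| ≤ ∫ ξ, ‖ψ ξ‖ * ‖trigSum u b (ξ / ε)‖ := by
    rw [← Real.norm_eq_abs, ← Complex.norm_real, hrep]
    refine (norm_integral_le_integral_norm _).trans_eq (integral_congr_ae (.of_forall fun ξ ↦ ?_))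
    simp only [norm_mul, Complex.norm_exp_ofReal_mul_I, one_mul]
    rw [mul_comm]
  have hscale : ∫ ξ, g (ξ / ε) * ‖trigSum u b (ξ / ε)‖ ^ 2 = ε * Q := by
    rw [Measure.integral_comp_div (fun ξ ↦ g ξ * ‖trigSum u b ξ‖ ^ 2), abs_of_pos hε, smul_eq_mul]
  have hscalei : Integrable fun ξ ↦ g (ξ / ε) * ‖trigSum u b (ξ / ε)‖ ^ 2 :=
    (integrable_mul_norm_trigSum_sq hg u b).comp_div hε.ne'
  have hdens : ∀ ξ, c * (ε * E) / (2 * Real.pi * |ξ| + 1) ^ 3 ≤ g (ξ / ε) := by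
    intro ξ
    refine le_trans ?_ (hgc (ξ / ε))
    have hp := Real.pi_pos
    set B : ℝ := 2 * Real.pi * |ξ| + 1 with hB
    have hB1 : 1 ≤ B := le_add_of_nonneg_left (by positivity)
    have hB0 : 0 < B := by linarith
    have h1 : |2 * Real.pi * (ξ / ε)| + 1 ≤ B / ε := by
      rw [abs_mul, abs_div, abs_of_pos hε, abs_of_pos (by positivity : 0 < 2 * Real.pi),
        le_div_iff₀ hε, hB, add_mul, mul_assoc, div_mul_cancel₀ _ hε.ne', one_mul]
      linarith
    have h2 : (|2 * Real.pi * (ξ / ε)| + 1) ^ (1 + 2 * H) ≤ B ^ 3 / (ε * E) := by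
      calc (|2 * Real.pi * (ξ / ε)| + 1) ^ (1 + 2 * H) ≤ (B / ε) ^ (1 + 2 * H) :=
            Real.rpow_le_rpow (by positivity) h1 (by linarith)
        _ = B ^ (1 + 2 * H) / (ε * E) := by
            rw [Real.div_rpow hB0.le hε.le, Real.rpow_add hε, Real.rpow_one]
        _ ≤ B ^ 3 / (ε * E) := by
            gcongr
            rw [← Real.rpow_natCast]
            exact Real.rpow_le_rpow_of_exponent_le hB1 (by norm_num; linarith)
    calc c * (ε * E) / B ^ 3 = c / (B ^ 3 / (ε * E)) := by field_simp
      _ ≤ _ := by gcongr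
  -- Parameter of the weighted AM–GM inequality, chosen so that the `T` term absorbs at most `|b
  -- i₀|`, half of the left side of `hmain`.
  set K : ℝ := |b i₀| * E / A with hK
  have hb0 : 0 < |b i₀| := abs_pos.mpr hb
  have hK0 : 0 < K := by positivity
  have hpt : ∀ ξ, 2 * (‖ψ ξ‖ * ‖trigSum u b (ξ / ε)‖)
      ≤ K / (c * E) * T ξ + (ε * K)⁻¹ * (g (ξ / ε) * ‖trigSum u b (ξ / ε)‖ ^ 2) := by
    intro ξ
    have hp := Real.pi_pos
    have h1 := hdens ξ
    set B : ℝ := (2 * Real.pi * |ξ| + 1) ^ 3 with hB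
    have hB0 : 0 < B := by positivity
    set x := ‖ψ ξ‖
    set y := ‖trigSum u b (ξ / ε)‖
    calc 2 * (x * y) ≤ K / (c * E) * (x ^ 2 * B)
          + (ε * K)⁻¹ * (c * (ε * E) / B * y ^ 2) := by
          have h2 : K / (c * E) * (x ^ 2 * B) + (ε * K)⁻¹ * (c * (ε * E) / B * y ^ 2) - 2 * (x * y)
              = (K * B * x - c * E * y) ^ 2 / (K * B * c * E) := by
            field_simp
            ring
          have h3 : 0 ≤ (K * B * x - c * E * y) ^ 2 / (K * B * c * E) := by positivity
          linarith
      _ ≤ _ := by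
          simp only [hT]
          gcongr
  have hmain : 2 * |b i₀| ≤ K / (c * E) * (∫ ξ, T ξ) + (ε * K)⁻¹ * (ε * Q) := by
    have hψN : Integrable fun ξ ↦ ‖ψ ξ‖ * ‖trigSum u b (ξ / ε)‖ := by
      refine hψi.norm.mul_bdd (c := ∑ i, |b i|) ?_ (.of_forall fun ξ ↦ ?_)
      · exact ((continuous_trigSum u b).comp (continuous_id.div_const ε)).norm.aestronglyMeasurable
      · rw [norm_norm]
        exact norm_trigSum_le u b _
    calc 2 * |b i₀| ≤ ∫ ξ, 2 * (‖ψ ξ‖ * ‖trigSum u b (ξ / ε)‖) := by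
          rw [integral_const_mul]; linarith
      _ ≤ ∫ ξ, (K / (c * E) * T ξ + (ε * K)⁻¹ * (g (ξ / ε) * ‖trigSum u b (ξ / ε)‖ ^ 2)) :=
          integral_mono (hψN.const_mul 2) ((hTi.const_mul _).add (hscalei.const_mul _)) hpt
      _ = _ := by
          rw [integral_add (hTi.const_mul _) (hscalei.const_mul _), integral_const_mul,
            integral_const_mul, hscale]
  have h1 : K / (c * E) * (∫ ξ, T ξ) ≤ |b i₀| := by
    have h2 : K / (c * E) * (∫ ξ, T ξ) = |b i₀| * (((∫ ξ, T ξ) / c) / A) := by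
      rw [hK]; field_simp
    rw [h2]
    refine mul_le_of_le_one_right hb0.le ((div_le_one hA0).mpr ?_)
    rw [hA]; linarith
  have h2 : (ε * K)⁻¹ * (ε * Q) = A * Q / (|b i₀| * E) := by
    rw [hK]; field_simp
  rw [h2] at hmain
  have h3 : |b i₀| ≤ A * Q / (|b i₀| * E) := by linarith
  rw [le_div_iff₀ (by positivity)] at h3
  rw [inv_mul_le_iff₀ hA0, ← sq_abs]
  linarith

/-! ### Strong local nondeterminism -/

theorem theoremA1 (H : ℝ) (hH0 : 0 < H) (hH1 : H < 1) (c : ℝ) (hc : 0 < c) :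
    ∃ κ : ℝ, 0 < κ ∧
      ∀ {Ω : Type*} [MeasurableSpace Ω] (P : Measure Ω) [IsProbabilityMeasure P]
        (Z : ℝ≥0 → Ω → ℝ),
        (∀ t, Measurable (Z t)) →
        IsGaussianProcess Z P →
        (∀ t, ∫ ω, Z t ω ∂P = 0) →
        IsSelfSimilar Z H P →
        (∀ t : ℝ, 0 ≤ t → 0 ≤ lampertiCov Z H P t) →
        AntitoneOn (lampertiCov Z H P) (Set.Ici 0) →
        Integrable (lampertiCov Z H P) →
        (∀ l : ℝ, c / (|l| + 1) ^ (1 + 2 * H) ≤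
          ∫ t in Set.Ioi (0 : ℝ), lampertiCov Z H P t * Real.cos (t * l)) →
        StrongLocalNondeterminismWith Z H κ P := by
  obtain ⟨κ, hκ, hmain⟩ :=
    exists_mul_rpow_le_integral_mul_norm_trigSum_sq H hH0 hH1 c hc
  refine ⟨κ, hκ, ?_⟩
  intro Ω _ P _ Z hZm hZ hZ0 hZs hr0 hanti hint hcos m hm s _ hs t hst
  set R := lampertiCov Z H P
  have heven : ∀ x, R (-x) = R x := hZs.lampertiCov_neg
  set g : ℝ → ℝ := fun ξ ↦ 2 * ∫ x in Set.Ioi (0 : ℝ), R x * Real.cos (x * (2 * Real.pi * ξ))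
  have hFg := fourier_ofReal_of_even hint heven
  have hlow : ∀ ξ, c / (|2 * Real.pi * ξ| + 1) ^ (1 + 2 * H) ≤ g ξ := fun ξ ↦ by
    have h1 := hcos (2 * Real.pi * ξ)
    have h2 : 0 ≤ c / (|2 * Real.pi * ξ| + 1) ^ (1 + 2 * H) := by positivity
    simp only [g]
    linarith
  have hbdd : ∀ x, |R x| ≤ R 0 := fun x ↦ by
    have h1 : R x = R |x| := by rcases abs_choice x with h | h <;> rw [h]; rw [heven]
    rw [h1, abs_of_nonneg (hr0 _ (abs_nonneg x))]
    exact hanti (Set.mem_Ici.mpr le_rfl) (Set.mem_Ici.mpr (abs_nonneg x)) (abs_nonneg x)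
  have hgi : Integrable g := integrable_of_fourier_eq_ofReal_nonneg hint hbdd
    (fun ξ ↦ le_trans (by positivity) (hlow ξ)) hFg
  obtain ⟨hinv, hinv0⟩ := fourier_inversion_of_antitoneOn hint heven hanti hgi hFg
  obtain ⟨a, ha⟩ := hZ.exists_condVar_ae_eq hZm hZ0 t s
  have : Nonempty (Fin m) := ⟨⟨0, hm⟩⟩
  obtain ⟨j₀, hj₀⟩ := Finite.exists_max s
  filter_upwards [ha] with ω hω
  rw [hω]
  have ht : 0 < t := (hs j₀).trans (hst j₀)
  have ht' : (0 : ℝ) < t := ht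
  -- The index `none` carries the predicted time `t`, with coefficient `1`.
  let τ : Option (Fin m) → ℝ≥0 := fun i ↦ i.elim t s
  let α : Option (Fin m) → ℝ := fun i ↦ i.elim 1 (fun j ↦ -a j)
  have hτ : ∀ i, 0 < τ i := by rintro (_ | j); exacts [ht, hs j]
  set u : Option (Fin m) → ℝ := fun i ↦ Real.log (τ i)
  set b : Option (Fin m) → ℝ := fun i ↦ α i * (τ i : ℝ) ^ H
  -- By `1 - x⁻¹ ≤ log x` this bounds the logarithmic gaps from below; unlike `log (t / s j₀)` it is
  -- at most `1`, and `ε * t` is exactly `t - s j₀`.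
  set ε : ℝ := 1 - s j₀ / t with hε
  have hsj : (s j₀ : ℝ) < t := hst j₀
  have hε0 : 0 < ε := by rw [hε, sub_pos, div_lt_one ht']; exact hsj
  have hε1 : ε ≤ 1 := by rw [hε]; linarith [div_nonneg (s j₀).coe_nonneg t.coe_nonneg]
  have hsep : ∀ i, i ≠ none → ε ≤ |u i - u none| := by
    rintro (_ | j) h
    · exact absurd rfl h
    · have hsj' : (0 : ℝ) < s j := hs j
      have h1 : 1 - (s j : ℝ) / t ≤ Real.log t - Real.log (s j) := by
        rw [← Real.log_div ht'.ne' hsj'.ne', ← inv_div]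
        exact Real.one_sub_inv_le_log_of_pos (by positivity)
      have h2 : (s j : ℝ) / t ≤ s j₀ / t := by
        have : (s j : ℝ) ≤ s j₀ := hj₀ j
        gcongr
      have h3 : u none - u (some j) = Real.log t - Real.log (s j) := rfl
      rw [abs_sub_comm, h3]
      exact le_trans (by rw [hε]; linarith) (le_abs_self _)
  have hL2 : ∀ t, MemLp (Z t) 2 P := fun t ↦ (hZ.hasGaussianLaw_eval t).memLp_two
  have hform : ∫ ω, (Z t ω - ∑ i, a i * Z (s i) ω) ^ 2 ∂P
      = ∑ i, ∑ j, b i * b j * R (u i - u j) := by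
    have h1 : ∀ ω, (Z t ω - ∑ i, a i * Z (s i) ω) ^ 2
        = ∑ i, ∑ j, α i * α j * (Z (τ i) ω * Z (τ j) ω) := by
      intro ω
      have h2 : Z t ω - ∑ i, a i * Z (s i) ω = ∑ i, α i * Z (τ i) ω := by
        rw [Fintype.sum_option]
        simp [α, τ, sub_eq_add_neg]
      rw [h2, sq, Finset.sum_mul_sum]
      refine Finset.sum_congr rfl fun i _ ↦ Finset.sum_congr rfl fun j _ ↦ ?_
      ring
    have h3 : ∀ i j, Integrable (fun ω ↦ α i * α j * (Z (τ i) ω * Z (τ j) ω)) P := fun i j ↦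
      ((hL2 _).integrable_mul (hL2 _)).const_mul _
    simp_rw [h1]
    rw [integral_finsetSum _ fun i _ ↦ integrable_finsetSum _ fun j _ ↦ h3 i j]
    refine Finset.sum_congr rfl fun i _ ↦ ?_
    rw [integral_finsetSum _ fun j _ ↦ h3 i j]
    refine Finset.sum_congr rfl fun j _ ↦ ?_
    rw [integral_const_mul, hZs.integral_mul_eq_lampertiCov (hτ i) (hτ j), ← heven, neg_sub]
    simp only [b, u, R]
    ring
  rw [hform]
  refine le_trans ?_ ((hmain g hgi hlow u b none ε hε0 hε1 hsep).trans
    (integral_mul_norm_trigSum_sq_le hgi hinv hinv0 u b))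
  refine mul_le_mul_of_nonneg_left ?_ hκ.le
  refine (ciInf_le (Set.finite_range _).bddBelow j₀).trans_eq ?_
  have h1 : b none = (t : ℝ) ^ H := one_mul _
  rw [h1, ← Real.rpow_natCast, ← Real.rpow_mul ht'.le, mul_comm H, Nat.cast_ofNat,
    ← Real.mul_rpow hε0.le ht'.le, abs_of_pos (sub_pos.mpr hsj)]
  congr 1
  rw [hε, sub_mul, one_mul, div_mul_cancel₀ _ ht'.ne']
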